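/- **Setting.** A *database* assigns to each relation name $R$, which has a finite non-empty set of attributes, a finite bag of tuples over some domain. A *full conjunctive query* $Q=\bigwedge_{i} R_i(\mathbf V_i)$ is a finite conjunction of atoms; an atom puts distinct variables at the attributes of its relation, several atoms may use the same relation, every variable of $Q$ occurs in some atom, and there are no selection predicates. Under bag semantics a valuation $\theta$ of the variables has multiplicity $\prod_i R_i(\theta(\mathbf V_i))$ in $Q(D)$, where $R_i(t)$ is the multiplicity of the tuple $t$ in $R_i$, and $|Q(D)|$ is the sum of these multiplicities. $Q$ is *Berge-acyclic* if the bipartite incidence graph between its atoms and its variables has no cycle. The *degree sequence* $f_{R.V}(1)\ge f_{R.V}(2)\ge\cdots$ of an attribute $V$ of a relation $R$ of $D$ lists the frequencies of the values of that column in descending order, followed by zeros; its *cumulative degree sequence* (CDS) is $F_{R.V}(i)=\sum_{j=1}^{i} f_{R.V}(j)$. In general, a degree sequence is a non-increasing sequence $f(1)\ge f(2)\ge\cdots\ge 0$ of real numbers that is eventually $0$, and a CDS is the sequence $F(i)=\sum_{j=1}^i f(j)$, $i \ge 0$, of such an $f=\Delta F$, where $\Delta F(i)=F(i)-F(i-1)$.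 Let $\hat S$ be a family of CDSs $\hat F_{R.V}$, one for each attribute $V$ of each relation $R$. Write $D\models\hat S$ if $F_{R.V}(i)\le\hat F_{R.V}(i)$ for all $R,V,i$. The *worst-case instance* $W(\Delta\hat S)$ has the ranks $1,2,\dots$ as values. Its relation $W_R$ is obtained by filling, in the column $V$, the first $\Delta\hat F_{R.V}(1)$ rows with the value $1$, the next $\Delta\hat F_{R.V}(2)$ rows with the value $2$, and so on, and by keeping the rows that are filled in every column. That is, the tuple $(i_V)_V$ has in $W_R$ the multiplicity $$\max\Bigl(0,\ \min_V \hat F_{R.V}(i_V)-\max_V \hat F_{R.V}(i_V-1)\Bigr),$$ which is a natural number if $\hat S$ is integer-valued and a non-negative real weight in general; $|Q(W(\Delta\hat S))|$ and $|W_R|$ are computed with these multiplicities as for bags. **Theorem.** Let $Q$ be a Berge-acyclic full conjunctive query and let $\hat S$ be a family of CDSs, one for each attribute of each relation. Then every database $D$ with $D\models\hat S$ satisfies $$|Q(D)|\ \le\ |Q(W(\Delta\hat S))|.$$ Moreover, relation cardinalities are preserved: for such $D$ and every relation $R$, if for some attribute $V$ of $R$ one has $\hat F_{R.V}(i)=|R|$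 for all large $i$ (where $|R|$ is the cardinality of $R$ in $D$), then $|W_R|=|R|$. -/

import Mathlib

open scoped NNReal

namespace SafeBound

noncomputable section

/-- A bag over `α` with multiplicities in `K`. For `K = ℕ` this is an ordinary finite bag; for
`K = ℝ≥0` it is a weighted bag, which is what degree sequences with fractional entries produce. -/
abbrev Bag (K : Type*) [Zero K] (α : Type*) := α →₀ K

/-- The cardinality of a bag, counted with multiplicity. -/
def Bag.size {K α : Type*} [AddCommMonoid K] (b : Bag K α) : K :=
  Finsupp.sum b fun _ m => m

/-- A database instance: the relation with name `r` has the set of attributes `Attr r`, and is a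
bag of tuples, i.e. of functions from `Attr r` to the domain. -/
abbrev Database (K : Type*) [Zero K] {Rel : Type*} (Attr : Rel → Type*) (Dom : Type*) :=
  (r : Rel) → Bag K (Attr r → Dom)

/-! ### Full conjunctive queries -/

/-- A full conjunctive query `⋀ i, R_i(V_i)`. The atom `i` refers to the relation name `rel i`
(several atoms may use the same name) and puts the variable `var i a` at the attribute `a`. The
variables of one atom are distinct, and every variable of the query occurs in some atom. -/
structure CQ {Rel : Type*} (Attr : Rel → Type*) (Atom Var : Type*) where
  rel : Atom → Rel
  var : (i : Atom) → Attr (rel i) → Var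
  var_injective : ∀ i, Function.Injective (var i)
  var_occurs : ∀ v, ∃ i a, var i a = v

namespace CQ

variable {Rel : Type*} {Attr : Rel → Type*} {Atom Var : Type*}

/-- The incidence graph of the query: atoms on one side, variables on the other, and an edge
between an atom and each of its variables. -/
def incidenceGraph (Q : CQ Attr Atom Var) : SimpleGraph (Atom ⊕ Var) :=
  SimpleGraph.fromRel fun x y => ∃ i a, x = Sum.inl i ∧ y = Sum.inr (Q.var i a)

/-- A query is Berge-acyclic if its incidence graph has no cycle. -/
def BergeAcyclic (Q : CQ Attr Atom Var) : Prop :=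
  Q.incidenceGraph.IsAcyclic

variable {K Dom : Type*} [CommSemiring K] [Fintype Atom]

/-- The multiplicity of the valuation `θ` in the output of `Q` on `D` under bag semantics. -/
def multiplicity (Q : CQ Attr Atom Var) (D : Database K Attr Dom) (θ : Var → Dom) : K :=
  ∏ i, D (Q.rel i) fun a => θ (Q.var i a)

theorem finite_support_multiplicity (Q : CQ Attr Atom Var) (D : Database K Attr Dom) :
    (Function.support (Q.multiplicity D)).Finite := by
  classical
  let g : (Var → Dom) → ((i : Atom) → Attr (Q.rel i) → Dom) := fun θ i a => θ (Q.var i a)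
  have hg : Function.Injective g := by
    intro θ θ' h
    funext v
    obtain ⟨i, a, rfl⟩ := Q.var_occurs v
    exact congrFun (congrFun h i) a
  have hfin : {f : (i : Atom) → Attr (Q.rel i) → Dom | ∀ i, f i ∈
      ((D (Q.rel i)).support : Set (Attr (Q.rel i) → Dom))}.Finite :=
    Set.Finite.pi' fun i => (D (Q.rel i)).support.finite_toSet
  refine (hfin.preimage hg.injOn).subset ?_
  intro θ hθ i
  simp only [Finset.mem_coe, Finsupp.mem_support_iff]
  intro h0
  exact hθ (Finset.prod_eq_zero (Finset.mem_univ i) h0)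

/-- The output `Q(D)`: a bag of valuations of all the variables. -/
def eval (Q : CQ Attr Atom Var) (D : Database K Attr Dom) : Bag K (Var → Dom) :=
  Finsupp.ofSupportFinite (Q.multiplicity D) (Q.finite_support_multiplicity D)

end CQ

/-! ### Degree sequences of a database -/

section Degrees

variable {Rel : Type*} {Attr : Rel → Type*} {Dom : Type*}

open Classical in
/-- The frequency of the value `v` in the column `a` of the relation `R`. -/
def freq {A : Type*} (R : Bag ℕ (A → Dom)) (a : A) (v : Dom) : ℕ :=
  Finsupp.sum R fun τ m => if τ a = v then m else 0

open Classical in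
/-- The frequencies of the values that occur in the column `a` of `R`, in descending order. -/
def sortedFreqs {A : Type*} (R : Bag ℕ (A → Dom)) (a : A) : List ℕ :=
  ((R.support.image fun τ => τ a).val.map (freq R a)).sort (· ≥ ·)

/-- The degree sequence of the column `a` of `R`, at the ranks `1, 2, …`; it is zero beyond the
number of distinct values in the column. -/
def degSeq {A : Type*} (R : Bag ℕ (A → Dom)) (a : A) (i : ℕ) : ℕ :=
  (sortedFreqs R a).getD (i - 1) 0

/-- The cumulative degree sequence of the column `a` of `R`. -/
def cumDegSeq {A : Type*} (R : Bag ℕ (A → Dom)) (a : A) (i : ℕ) : ℕ :=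
  ∑ j ∈ Finset.Icc 1 i, degSeq R a j

end Degrees

/-! ### Abstract degree sequences and cumulative degree sequences -/

/-- A degree sequence: a non-increasing sequence `f 1 ≥ f 2 ≥ …` of non-negative numbers that is
eventually zero. The entry `f 0` has no meaning and is never used. -/
structure DegreeSequence where
  f : ℕ → ℝ≥0
  nonincreasing : ∀ i, 1 ≤ i → f (i + 1) ≤ f i
  eventually_zero : ∃ n, ∀ i, n < i → f i = 0

/-- The running sum `f 1 + ⋯ + f i`. -/
def DegreeSequence.cum (s : DegreeSequence) (i : ℕ) : ℝ≥0 :=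
  ∑ j ∈ Finset.Icc 1 i, s.f j

/-- A cumulative degree sequence: it starts at zero, is non-decreasing, has non-increasing
increments, and is eventually constant. -/
structure CumulativeDegreeSequence where
  F : ℕ → ℝ≥0
  zero : F 0 = 0
  mono : Monotone F
  increments_nonincreasing : ∀ i, 1 ≤ i → F (i + 1) - F i ≤ F i - F (i - 1)
  eventually_const : ∃ n, ∀ i, n ≤ i → F i = F n

/-- The discrete derivative `Δ F i = F i - F (i - 1)` of a cumulative degree sequence. -/
def CumulativeDegreeSequence.delta (S : CumulativeDegreeSequence) : DegreeSequence where
  f i := S.F i - S.F (i - 1)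
  nonincreasing i hi := by simpa using S.increments_nonincreasing i hi
  eventually_zero := by
    obtain ⟨n, hn⟩ := S.eventually_const
    refine ⟨n, fun i hi => ?_⟩
    rw [hn i hi.le, hn (i - 1) (by omega), tsub_self]

/-- `D ⊨ S`: each cumulative degree sequence of `D` is dominated pointwise by the one in `S`. -/
def Satisfies {Rel : Type*} {Attr : Rel → Type*} {Dom : Type*} (D : Database ℕ Attr Dom)
    (S : (r : Rel) → Attr r → CumulativeDegreeSequence) : Prop :=
  ∀ r a i, (cumDegSeq (D r) a i : ℝ≥0) ≤ (S r a).F i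

/-! ### The worst-case instance -/

section WorstCase

variable {A : Type*} [Fintype A] [Nonempty A]

/-- The multiplicity of the tuple of ranks `τ` in the worst-case relation.

List each column separately, with the value of rank `1` in the first `f 1` rows, the value of rank
`2` in the next `f 2` rows, and so on. The value of rank `τ a` fills the rows in the interval
`(cum (τ a - 1), cum (τ a)]` of the column `a`, so the tuple `τ` fills the rows that lie in all
these intervals. Their number is the length of the intersection (zero if it is empty; the
subtraction is truncated). -/
def worstCaseMult (s : A → DegreeSequence) (τ : A → ℕ) : ℝ≥0 :=
  (Finset.univ.inf' Finset.univ_nonempty fun a => (s a).cum (τ a)) -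
    Finset.univ.sup' Finset.univ_nonempty fun a => (s a).cum (τ a - 1)

theorem finite_support_worstCaseMult (s : A → DegreeSequence) :
    (Function.support (worstCaseMult s)).Finite := by
  classical
  choose n hn using fun a => (s a).eventually_zero
  refine (Set.Finite.pi' fun a => Set.finite_Iic (n a)).subset ?_
  intro τ hτ a
  by_contra hlt
  have hlt : n a < τ a := by simpa using hlt
  apply hτ
  apply tsub_eq_zero_of_le
  have h1 : (s a).cum (τ a) = (s a).cum (τ a - 1) := by
    obtain ⟨m, hm⟩ : ∃ m, τ a = m + 1 := ⟨τ a - 1, by omega⟩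
    simp only [DegreeSequence.cum, hm, Nat.add_sub_cancel]
    rw [Finset.sum_Icc_succ_top (by omega), hn a (m + 1) (by omega), add_zero]
  calc (Finset.univ.inf' Finset.univ_nonempty fun a => (s a).cum (τ a))
      ≤ (s a).cum (τ a) := Finset.inf'_le _ (Finset.mem_univ a)
    _ = (s a).cum (τ a - 1) := h1
    _ ≤ _ := Finset.le_sup' (fun a => (s a).cum (τ a - 1)) (Finset.mem_univ a)

/-- The worst-case relation of a set of degree sequences, one for each attribute. Its values are
the ranks `1, 2, …`. -/
def worstCaseRelation (s : A → DegreeSequence) : Bag ℝ≥0 (A → ℕ) :=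
  Finsupp.ofSupportFinite (worstCaseMult s) (finite_support_worstCaseMult s)

/-- For integer degree sequences the worst-case relation is an ordinary bag: the multiplicity of
`τ` is the number of rows `t = 1, 2, …` that hold, in each column `a`, the value of rank `τ a`. -/
theorem worstCaseRelation_apply_of_nat (s : A → DegreeSequence) (c : A → ℕ → ℕ)
    (hc : ∀ a i, (s a).cum i = c a i) (τ : A → ℕ) :
    worstCaseRelation s τ =
      ({t : ℕ | ∀ a, c a (τ a - 1) < t ∧ t ≤ c a (τ a)}.ncard : ℝ≥0) := by
  have hset : {t : ℕ | ∀ a, c a (τ a - 1) < t ∧ t ≤ c a (τ a)} =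
      ((Finset.Ioc (Finset.univ.sup' Finset.univ_nonempty fun a => c a (τ a - 1))
        (Finset.univ.inf' Finset.univ_nonempty fun a => c a (τ a)) : Finset ℕ) : Set ℕ) := by
    ext t
    simp [forall_and]
  have hmono : Monotone (Nat.cast : ℕ → ℝ≥0) := Nat.mono_cast
  rw [hset, Set.ncard_coe_finset, Nat.card_Ioc, Nat.cast_tsub]
  change worstCaseMult s τ = _
  unfold worstCaseMult
  congr 1
  · rw [Finset.apply_inf'_eq_inf'_comp Finset.univ_nonempty (Nat.cast : ℕ → ℝ≥0)
      (fun x y => hmono.map_min)]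
    simp [hc]
  · rw [Finset.apply_sup'_eq_sup'_comp Finset.univ_nonempty (Nat.cast : ℕ → ℝ≥0)
      (fun x y => hmono.map_max)]
    simp [hc]

end WorstCase

/-- The worst-case instance: the worst-case relation of each relation name. -/
def worstCase {Rel : Type*} {Attr : Rel → Type*} [∀ r, Fintype (Attr r)]
    [∀ r, Nonempty (Attr r)] (s : (r : Rel) → Attr r → DegreeSequence) :
    Database ℝ≥0 Attr ℕ :=
  fun r => worstCaseRelation (s r)

end

end SafeBound

/-!
The bound is a majorization argument carried out on tensors. A set of atoms of the query defines a
tensor on valuations, the product of the multiplicities of its atoms: one tensor `f` for the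
database `D`, and one tensor `g` on valuations by ranks for the worst-case instance. Two properties
are propagated together (`CQ.BergeAcyclic.majorizedBy_prod`).

* `MajorizedBy f g`: over any box `∏ v, S v` of values, the sum of `f` is at most the sum of `g`
  over the box of the first `#(S v)` ranks. Applied to all atoms and to a box that contains the
  output of the query on `D`, this is the claimed inequality.
* `AntitoneSlices g`: within a box of first ranks, the slice sums of `g` in each direction are
  non-increasing in the rank.

For one atom, a box sum of the relation of `D` is at most `F a #(S a)` for each column `a`, since
any `k` frequencies sum to at most the `k` largest (`boxSum_le_cumDegSeq`). The worst-case relation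
attains the minimum over `a` of these bounds (`boxSum_worstCaseMult`), because its rows tile an
interval that starts at `0`; its slice sums are non-increasing because the minimum of a concave
sequence and a constant is concave.

In a Berge-acyclic query every non-empty set of atoms contains an atom that shares at most one
variable `v` with the others (`CQ.BergeAcyclic.exists_leaf`). So it remains to see that both
properties pass to the product of two tensors that share only `v` (`MajorizedBy.mul`,
`AntitoneSlices.mul`). Once the value of `v` is fixed, a box sum of the product factors, and the box
sum is a sum of products `a x * b x` over the values `x` of `v`; two Abel summations, one for each
factor, compare it with the same expression for the worst-case tensors, which are sorted in the
same order (`sum_mul_le_of_submajorized`).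

The statement on cardinalities is the formula for the box sums of the worst-case relation, taken
over a box that contains the whole relation.
-/

namespace SafeBound

open Finset

/-! ### Rearrangement and submajorization -/

/-- Abel summation: against non-increasing weights `c`, domination of the prefix sums of `p` by
those of `q` yields domination of the weighted sums. -/
theorem sum_mul_le_sum_mul_of_prefix_le {p q c : ℕ → ℝ≥0} {n : ℕ}
    (hpq : ∀ m ≤ n, ∑ i ∈ Icc 1 m, p i ≤ ∑ i ∈ Icc 1 m, q i)
    (hc : ∀ i, 1 ≤ i → i < n → c (i + 1) ≤ c i) :
    ∑ i ∈ Icc 1 n, p i * c i ≤ ∑ i ∈ Icc 1 n, q i * c i := by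
  -- the difference of the weighted sums is at least that of the prefix sums, times the last weight
  have key : ∀ m, m ≤ n →
      (∑ i ∈ Icc 1 m, p i * c i) + (∑ i ∈ Icc 1 m, q i) * c m ≤
        (∑ i ∈ Icc 1 m, q i * c i) + (∑ i ∈ Icc 1 m, p i) * c m := by
    intro m
    induction m with
    | zero => simp
    | succ m ih =>
      intro hm
      have ih := ih (by omega)
      have h1 := hpq m (by omega)
      simp only [Finset.sum_Icc_succ_top (Nat.le_add_left 1 m)]
      rcases Nat.eq_zero_or_pos m with rfl | hm0
      · simp [add_comm]
      have h2 := hc m hm0 (by omega)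
      rw [← NNReal.coe_le_coe] at *
      push_cast at *
      nlinarith [mul_nonneg (sub_nonneg.2 h1) (sub_nonneg.2 h2)]
  have := key n le_rfl
  have h2 : (∑ i ∈ Icc 1 n, p i) * c n ≤ (∑ i ∈ Icc 1 n, q i) * c n := by
    gcongr ?_ * _
    exact hpq n le_rfl
  exact le_of_add_le_add_right (this.trans (by gcongr))

/-- The elements of a finite set can be listed, at the positions `1, 2, …`, in descending order of
a given weight. -/
theorem exists_antitone_listing {X : Type*} [DecidableEq X] [Nonempty X] (b : X → ℝ≥0)
    (T : Finset X) :
    ∃ x : ℕ → X, Set.InjOn x (Icc 1 #T) ∧ (Icc 1 #T).image x = T ∧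
      ∀ i, 1 ≤ i → i < #T → b (x (i + 1)) ≤ b (x i) := by
  refine induction_on_min_value (motive := fun T : Finset X => ∃ x : ℕ → X,
    Set.InjOn x (Icc 1 #T) ∧ (Icc 1 #T).image x = T ∧
      ∀ i, 1 ≤ i → i < #T → b (x (i + 1)) ≤ b (x i)) b T ?_ ?_
  · simp
  · rintro y s hy hmin ⟨x, hinj, himg, hanti⟩
    have hmem : ∀ i, 1 ≤ i → i ≤ #s → x i ∈ s := fun i h1 h2 => by
      rw [← himg]; exact mem_image_of_mem x (mem_Icc.2 ⟨h1, h2⟩)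
    have hx : ∀ i, i ≤ #s → Function.update x (#s + 1) y i = x i := fun i h =>
      Function.update_of_ne (by omega) _ _
    have himg' : (Icc 1 (#s + 1)).image (Function.update x (#s + 1) y) = insert y s := by
      rw [← insert_Icc_right_eq_Icc_add_one (by omega : 1 ≤ #s + 1), image_insert,
        Function.update_self]
      congr 1
      conv_rhs => rw [← himg]
      exact image_congr fun i hi => hx i (mem_Icc.1 (mem_coe.1 hi)).2
    refine ⟨Function.update x (#s + 1) y, ?_, ?_, ?_⟩ <;> rw [card_insert_of_notMem hy]
    · apply injOn_of_card_image_eq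
      rw [himg', card_insert_of_notMem hy, Nat.card_Icc, Nat.add_sub_cancel]
    · exact himg'
    · intro i h1 h2
      rw [hx i (by omega)]
      rcases Nat.lt_succ_iff_lt_or_eq.1 h2 with h | rfl
      · rw [hx (i + 1) (by omega)]
        exact hanti i h1 h
      · rw [Function.update_self]
        exact hmin _ (hmem _ h1 le_rfl)

/-- If two weights on `X` are submajorized by two non-increasing sequences, then so is their
product by the product of the sequences. -/
theorem sum_mul_le_of_submajorized {X : Type*} {a b : X → ℝ≥0} {A B : ℕ → ℝ≥0}
    (ha : ∀ T : Finset X, ∑ x ∈ T, a x ≤ ∑ i ∈ Icc 1 #T, A i)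
    (hb : ∀ T : Finset X, ∑ x ∈ T, b x ≤ ∑ i ∈ Icc 1 #T, B i)
    (hA : ∀ i, 1 ≤ i → A (i + 1) ≤ A i) (T : Finset X) :
    ∑ x ∈ T, a x * b x ≤ ∑ i ∈ Icc 1 #T, A i * B i := by
  classical
  rcases T.eq_empty_or_nonempty with rfl | ⟨x₀, _⟩
  · simp
  have : Nonempty X := ⟨x₀⟩
  obtain ⟨x, hinj, himg, hanti⟩ := exists_antitone_listing b T
  have hprefix : ∀ (w : X → ℝ≥0) (W : ℕ → ℝ≥0),
      (∀ T : Finset X, ∑ x ∈ T, w x ≤ ∑ i ∈ Icc 1 #T, W i) →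
      ∀ m ≤ #T, ∑ i ∈ Icc 1 m, w (x i) ≤ ∑ i ∈ Icc 1 m, W i := by
    intro w W h m hm
    have hinj' : Set.InjOn x (Icc 1 m) :=
      hinj.mono (by simpa using Set.Icc_subset_Icc_right hm)
    have := h ((Icc 1 m).image x)
    rwa [sum_image hinj', card_image_of_injOn hinj', Nat.card_Icc, Nat.add_sub_cancel] at this
  calc ∑ y ∈ T, a y * b y = ∑ i ∈ Icc 1 #T, a (x i) * b (x i) := by
        conv_lhs => rw [← himg]
        exact sum_image hinj
    _ ≤ ∑ i ∈ Icc 1 #T, A i * b (x i) :=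
        sum_mul_le_sum_mul_of_prefix_le (hprefix a A ha) hanti
    _ = ∑ i ∈ Icc 1 #T, b (x i) * A i := by simp only [mul_comm]
    _ ≤ ∑ i ∈ Icc 1 #T, B i * A i :=
        sum_mul_le_sum_mul_of_prefix_le (hprefix b B hb) fun i hi _ => hA i hi
    _ = _ := by simp only [mul_comm]

/-! ### Tensors and their box sums -/

/-- The box of ranks `∏ v, {1, …, k v}`. -/
def rankBox {V : Type*} (k : V → ℕ) (v : V) : Finset ℕ := Icc 1 (k v)

theorem update_rankBox {V : Type*} [DecidableEq V] (k : V → ℕ) (v : V) (m : ℕ) :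
    Function.update (rankBox k) v (Icc 1 m) = rankBox (Function.update k v m) := by
  funext u
  by_cases hu : u = v
  · subst hu; simp [rankBox]
  · simp [rankBox, hu]

theorem piecewise_rankBox {V : Type*} [DecidableEq V] (P : Finset V) (k : V → ℕ) :
    P.piecewise (rankBox k) (fun _ => {1}) = rankBox (P.piecewise k 1) := by
  funext u
  by_cases hu : u ∈ P <;> simp [rankBox, hu]

theorem piecewise_rankBox' {V : Type*} [DecidableEq V] (P : Finset V) (k : V → ℕ) :
    P.piecewise (fun _ => {1}) (rankBox k) = rankBox (P.piecewise 1 k) := by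
  funext u
  by_cases hu : u ∈ P <;> simp [rankBox, hu]

section Tensor

variable {V : Type*} [Fintype V] [DecidableEq V] {X : Type*}

/-- The sum of a tensor `f`, indexed by valuations, over the box `∏ v, S v`. -/
def boxSum (f : (V → X) → ℝ≥0) (S : V → Finset X) : ℝ≥0 :=
  ∑ θ ∈ Fintype.piFinset S, f θ

theorem boxSum_update (f : (V → X) → ℝ≥0) (S : V → Finset X) (v : V) (T : Finset X) :
    boxSum f (Function.update S v T) = ∑ x ∈ T, boxSum f (Function.update S v {x}) := by
  classical
  unfold boxSum
  rw [← sum_fiberwise_of_maps_to (s := Fintype.piFinset (Function.update S v T)) (t := T)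
    (g := fun θ => θ v)]
  · refine sum_congr rfl fun x hx => sum_congr ?_ fun _ _ => rfl
    ext θ
    simp only [mem_filter, Fintype.mem_piFinset]
    constructor
    · rintro ⟨h, rfl⟩ u
      by_cases hu : u = v
      · subst hu; simp
      · simpa [hu] using h u
    · intro h
      have hv : θ v = x := by simpa using h v
      refine ⟨fun u => ?_, hv⟩
      by_cases hu : u = v
      · subst hu; simpa [hv] using hx
      · simpa [hu] using h u
  · intro θ hθ
    simpa using Fintype.mem_piFinset.1 hθ v

theorem boxSum_eq_sum_slices (f : (V → X) → ℝ≥0) (S : V → Finset X) (v : V) :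
    boxSum f S = ∑ x ∈ S v, boxSum f (Function.update S v {x}) := by
  rw [← boxSum_update, Function.update_eq_self]

/-- Let two tensors share at most the variable `v`. Over a box in which `v` is fixed, the sum of
their product is the product of their sums; in each factor the variables of the other tensor are
frozen at the values `c`, so that they are not counted. -/
theorem boxSum_mul_of_dependsOn {f f' : (V → X) → ℝ≥0} {P : Finset V} {v : V} {x : X}
    (hf : DependsOn f (insert v (P : Set V))) (hf' : DependsOn f' (insert v (P : Set V)ᶜ))
    (c : V → X) (S : V → Finset X) :
    boxSum (fun θ => f θ * f' θ) (Function.update S v {x}) =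
      boxSum f (Function.update (P.piecewise S fun u => {c u}) v {x}) *
        boxSum f' (Function.update (P.piecewise (fun u => {c u}) S) v {x}) := by
  classical
  unfold boxSum
  rw [sum_mul_sum, ← sum_product']
  set d : V → X := Function.update c v x with hd
  refine sum_bij' (fun θ _ => (P.piecewise θ d, P.piecewise d θ))
    (fun ab _ => P.piecewise ab.1 ab.2) ?_ ?_ ?_ ?_ ?_
  · intro θ hθ
    simp only [mem_product, Fintype.mem_piFinset] at hθ ⊢
    constructor <;> intro u <;> have := hθ u <;> by_cases hu : u = v <;> by_cases hP : u ∈ P <;>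
      simp_all
  · rintro ⟨α, β⟩ hab
    simp only [mem_product, Fintype.mem_piFinset] at hab ⊢
    intro u
    have h1 := hab.1 u
    have h2 := hab.2 u
    by_cases hu : u = v <;> by_cases hP : u ∈ P <;> simp_all
  · intro θ hθ
    funext u
    by_cases hP : u ∈ P <;> simp [hP]
  · rintro ⟨α, β⟩ hab
    simp only [mem_product, Fintype.mem_piFinset] at hab ⊢
    ext u <;> (have h1 := hab.1 u; have h2 := hab.2 u; by_cases hu : u = v <;>
      by_cases hP : u ∈ P <;> simp_all)
  · intro θ hθ
    have hv : θ v = x := by simpa using Fintype.mem_piFinset.1 hθ v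
    congr 1
    · apply hf
      rintro u (rfl | hu)
      · by_cases hP : u ∈ P <;> simp [hP, hv, hd]
      · simp [Finset.mem_coe.1 hu]
    · apply hf'
      rintro u (rfl | hu)
      · by_cases hP : u ∈ P <;> simp [hP, hv, hd]
      · have : u ∉ P := by simpa using hu
        simp [this]

theorem boxSum_mul_eq_sum {f f' : (V → X) → ℝ≥0} {P : Finset V} {v : V}
    (hf : DependsOn f (insert v (P : Set V))) (hf' : DependsOn f' (insert v (P : Set V)ᶜ))
    (c : V → X) (S : V → Finset X) :
    boxSum (fun θ => f θ * f' θ) S = ∑ x ∈ S v,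
      boxSum f (Function.update (P.piecewise S fun u => {c u}) v {x}) *
        boxSum f' (Function.update (P.piecewise (fun u => {c u}) S) v {x}) := by
  rw [boxSum_eq_sum_slices _ S v]
  exact sum_congr rfl fun x _ => boxSum_mul_of_dependsOn hf hf' c S

/-! ### Majorization of tensors -/

/-- The tensor `f` is submajorized by the rank tensor `g`: over every box, the sum of `f` is at
most the sum of `g` over the box of the first ranks with the same side lengths. -/
def MajorizedBy (f : (V → X) → ℝ≥0) (g : (V → ℕ) → ℝ≥0) : Prop :=
  ∀ S : V → Finset X, boxSum f S ≤ boxSum g (rankBox fun v => #(S v))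

/-- Within every box of first ranks, the sums over the slices in a given direction are
non-increasing in the rank. -/
def AntitoneSlices (g : (V → ℕ) → ℝ≥0) : Prop :=
  ∀ (k : V → ℕ) (v : V) (i : ℕ), 1 ≤ i →
    boxSum g (Function.update (rankBox k) v {i + 1}) ≤ boxSum g (Function.update (rankBox k) v {i})

/-- In each direction, the slice sums of `f` are submajorized by those of `g`. -/
theorem MajorizedBy.sum_slices_le {f : (V → X) → ℝ≥0} {g : (V → ℕ) → ℝ≥0} (h : MajorizedBy f g)
    (S : V → Finset X) (v : V) (T : Finset X) :
    ∑ x ∈ T, boxSum f (Function.update S v {x}) ≤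
      ∑ i ∈ Icc 1 #T, boxSum g (Function.update (rankBox fun u => #(S u)) v {i}) := by
  rw [← boxSum_update, ← boxSum_update]
  convert h (Function.update S v T) using 2
  rw [update_rankBox]
  congr 1
  funext u
  by_cases hu : u = v
  · subst hu; simp
  · simp [hu]

theorem MajorizedBy.mul {f f' : (V → X) → ℝ≥0} {g g' : (V → ℕ) → ℝ≥0} {P : Finset V} {v : V}
    (hf : DependsOn f (insert v (P : Set V))) (hf' : DependsOn f' (insert v (P : Set V)ᶜ))
    (hg : DependsOn g (insert v (P : Set V))) (hg' : DependsOn g' (insert v (P : Set V)ᶜ))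
    (h : MajorizedBy f g) (h' : MajorizedBy f' g') (ha : AntitoneSlices g) :
    MajorizedBy (fun θ => f θ * f' θ) (fun θ => g θ * g' θ) := by
  intro S
  rcases isEmpty_or_nonempty X with hX | ⟨⟨c⟩⟩
  · have : IsEmpty (V → X) := ⟨fun θ => hX.elim (θ v)⟩
    rw [boxSum, sum_of_isEmpty]
    exact zero_le
  rw [boxSum_mul_eq_sum hf hf' (fun _ => c), boxSum_mul_eq_sum hg hg' (fun _ => 1),
    piecewise_rankBox, piecewise_rankBox']
  refine sum_mul_le_of_submajorized ?_ ?_ (fun i hi => ha _ v i hi) (S v)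
  · intro T
    convert h.sum_slices_le (P.piecewise S fun _ => {c}) v T using 5
    ext u
    by_cases hu : u ∈ P <;> simp [hu]
  · intro T
    convert h'.sum_slices_le (P.piecewise (fun _ => {c}) S) v T using 5
    ext u
    by_cases hu : u ∈ P <;> simp [hu]

/-- The slices of a product in a direction `u ≠ v` of the first factor: they are sums over the
ranks of `v` with non-increasing weights from the second factor, so Abel summation applies. -/
theorem AntitoneSlices.mul_slice_le {g g' : (V → ℕ) → ℝ≥0} {P : Finset V} {v : V}
    (hg : DependsOn g (insert v (P : Set V))) (hg' : DependsOn g' (insert v (P : Set V)ᶜ))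
    (ha : AntitoneSlices g) (ha' : AntitoneSlices g') (k : V → ℕ) {u : V} (huv : u ≠ v)
    (hu : u ∈ P) {i : ℕ} (hi : 1 ≤ i) :
    boxSum (fun θ => g θ * g' θ) (Function.update (rankBox k) u {i + 1}) ≤
      boxSum (fun θ => g θ * g' θ) (Function.update (rankBox k) u {i}) := by
  have hS : ∀ j : ℕ, boxSum (fun θ => g θ * g' θ) (Function.update (rankBox k) u {j}) =
      ∑ x ∈ Icc 1 (k v), boxSum g (Function.update
          (Function.update (rankBox (P.piecewise k 1)) v {x}) u {j}) *
        boxSum g' (Function.update (rankBox (P.piecewise 1 k)) v {x}) := by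
    intro j
    rw [boxSum_mul_eq_sum hg hg' (fun _ => 1), Function.update_of_ne huv.symm]
    refine sum_congr rfl fun x _ => ?_
    rw [← piecewise_rankBox, ← piecewise_rankBox', Function.update_comm huv.symm]
    congr 3
    · funext w
      by_cases hw : w = u
      · subst hw; simp [hu]
      · by_cases hP : w ∈ P <;> simp [hw, hP]
    · funext w
      by_cases hw : w = u
      · subst hw; simp [hu]
      · by_cases hP : w ∈ P <;> simp [hw, hP]
  rw [hS, hS]
  refine sum_mul_le_sum_mul_of_prefix_le ?_ fun j hj _ => ha' _ v j hj
  intro m _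
  simp only [Function.update_comm huv.symm]
  rw [← boxSum_update, ← boxSum_update, Function.update_comm huv, Function.update_comm huv,
    update_rankBox]
  exact ha (Function.update (P.piecewise k 1) v m) u i hi

theorem AntitoneSlices.mul {g g' : (V → ℕ) → ℝ≥0} {P : Finset V} {v : V}
    (hg : DependsOn g (insert v (P : Set V))) (hg' : DependsOn g' (insert v (P : Set V)ᶜ))
    (ha : AntitoneSlices g) (ha' : AntitoneSlices g') :
    AntitoneSlices fun θ => g θ * g' θ := by
  intro k u i hi
  by_cases huv : u = v
  · subst huv
    rw [boxSum_mul_of_dependsOn hg hg' (fun _ => 1), boxSum_mul_of_dependsOn hg hg' (fun _ => 1),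
      piecewise_rankBox, piecewise_rankBox']
    exact mul_le_mul' (ha _ u i hi) (ha' _ u i hi)
  by_cases hu : u ∈ P
  · exact AntitoneSlices.mul_slice_le hg hg' ha ha' k huv hu hi
  · simp only [mul_comm (g _)]
    refine AntitoneSlices.mul_slice_le (P := Pᶜ) ?_ ?_ ha' ha k huv (by simpa using hu) hi
    · simpa using hg'
    · simpa using hg

end Tensor

/-! ### The worst-case relation -/

theorem DegreeSequence.cum_zero (s : DegreeSequence) : s.cum 0 = 0 := by
  simp [DegreeSequence.cum]

theorem DegreeSequence.cum_succ (s : DegreeSequence) (i : ℕ) :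
    s.cum (i + 1) = s.cum i + s.f (i + 1) := by
  rw [DegreeSequence.cum, sum_Icc_succ_top (Nat.le_add_left 1 i), DegreeSequence.cum]

theorem DegreeSequence.cum_mono (s : DegreeSequence) : Monotone s.cum :=
  monotone_nat_of_le_succ fun i => by rw [s.cum_succ]; exact le_self_add

theorem CumulativeDegreeSequence.cum_delta (S : CumulativeDegreeSequence) (i : ℕ) :
    S.delta.cum i = S.F i := by
  induction i with
  | zero => rw [DegreeSequence.cum_zero, S.zero]
  | succ i ih =>
    rw [DegreeSequence.cum_succ, ih]
    exact add_tsub_cancel_of_le (S.mono i.le_succ)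

section WorstCase

variable {A : Type*}

/-- The rows of the worst-case relation that carry the tuple of ranks `τ`. Multiplicities may be
fractional, so the rows are the points of a half-line, and are counted by Lebesgue measure. -/
def rowSet (s : A → DegreeSequence) (τ : A → ℕ) : Set ℝ :=
  {t | ∀ a, ((s a).cum (τ a - 1) : ℝ) ≤ t ∧ t < (s a).cum (τ a)}

theorem rowSet_disjoint (s : A → DegreeSequence) {τ τ' : A → ℕ} (h : τ ≠ τ') :
    Disjoint (rowSet s τ) (rowSet s τ') := by
  rw [Set.disjoint_left]
  intro t ht ht'
  apply h
  funext a
  have hmono : ∀ {i j : ℕ}, i < j → (s a).cum i ≤ (s a).cum (j - 1) := fun hij =>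
    (s a).cum_mono (by omega)
  obtain ⟨h1, h2⟩ := ht a
  obtain ⟨h3, h4⟩ := ht' a
  rcases lt_trichotomy (τ a) (τ' a) with hlt | heq | hlt
  · exact absurd (h2.trans_le ((NNReal.coe_le_coe.2 (hmono hlt)).trans h3)) (lt_irrefl _)
  · exact heq
  · exact absurd (h4.trans_le ((NNReal.coe_le_coe.2 (hmono hlt)).trans h1)) (lt_irrefl _)

variable [Fintype A] [Nonempty A]

theorem rowSet_eq_Ico (s : A → DegreeSequence) (τ : A → ℕ) :
    rowSet s τ = Set.Ico
      ((univ.sup' univ_nonempty fun a => (s a).cum (τ a - 1) : ℝ≥0) : ℝ)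
      ((univ.inf' univ_nonempty fun a => (s a).cum (τ a) : ℝ≥0) : ℝ) := by
  ext t
  simp only [rowSet, Set.mem_ofPred_eq, Set.mem_Ico]
  by_cases ht : 0 ≤ t
  · lift t to ℝ≥0 using ht
    simp only [NNReal.coe_le_coe, NNReal.coe_lt_coe, sup'_le_iff, lt_inf'_iff, mem_univ,
      true_imp_iff, forall_and]
  · constructor
    · intro h
      exact absurd ((NNReal.coe_nonneg _).trans (h (Classical.arbitrary A)).1) ht
    · rintro ⟨h, -⟩
      exact absurd ((NNReal.coe_nonneg _).trans h) ht

theorem volume_rowSet (s : A → DegreeSequence) (τ : A → ℕ) :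
    MeasureTheory.volume (rowSet s τ) = worstCaseMult s τ := by
  rw [rowSet_eq_Ico, Real.volume_Ico, worstCaseMult, ← ENNReal.ofReal_coe_nnreal,
    NNReal.coe_sub_def, ENNReal.ofReal_max, ENNReal.ofReal_zero, max_eq_left zero_le]

variable [DecidableEq A]

/-- The row sets of the tuples in a box of first ranks partition an interval that starts at `0`. -/
theorem biUnion_rowSet (s : A → DegreeSequence) (k : A → ℕ) :
    (⋃ τ ∈ Fintype.piFinset (rankBox k), rowSet s τ) =
      Set.Ico 0 ((univ.inf' univ_nonempty fun a => (s a).cum (k a) : ℝ≥0) : ℝ) := by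
  ext t
  simp only [Set.mem_iUnion, Fintype.mem_piFinset, rankBox, mem_Icc, exists_prop, Set.mem_Ico]
  constructor
  · rintro ⟨τ, hτ, ht⟩
    have ht0 : 0 ≤ t := (NNReal.coe_nonneg _).trans (ht (Classical.arbitrary A)).1
    lift t to ℝ≥0 using ht0
    refine ⟨t.2, ?_⟩
    rw [NNReal.coe_lt_coe, lt_inf'_iff]
    intro a _
    exact (NNReal.coe_lt_coe.1 (ht a).2).trans_le ((s a).cum_mono (hτ a).2)
  · rintro ⟨ht0, ht⟩
    lift t to ℝ≥0 using ht0
    rw [NNReal.coe_lt_coe, lt_inf'_iff] at ht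
    have hex : ∀ a, ∃ i, t < (s a).cum i := fun a => ⟨k a, ht a (mem_univ a)⟩
    refine ⟨fun a => Nat.find (hex a), fun a => ?_, fun a => ?_⟩
    · have hpos : Nat.find (hex a) ≠ 0 := by
        intro h0
        have := Nat.find_spec (hex a)
        rw [h0, DegreeSequence.cum_zero] at this
        exact not_lt_zero this
      exact ⟨Nat.one_le_iff_ne_zero.2 hpos, Nat.find_min' _ (ht a (mem_univ a))⟩
    · refine ⟨?_, NNReal.coe_lt_coe.2 (Nat.find_spec (hex a))⟩
      rw [NNReal.coe_le_coe]
      beta_reduce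
      by_cases h0 : Nat.find (hex a) = 0
      · rw [h0]; simp [DegreeSequence.cum_zero]
      · exact not_lt.1 (Nat.find_min (hex a) (by omega))

/-- The number of rows of the worst-case relation whose ranks are at most `k a` in each column `a`:
only the most restrictive column matters. -/
theorem boxSum_worstCaseMult (s : A → DegreeSequence) (k : A → ℕ) :
    boxSum (worstCaseMult s) (rankBox k) =
      univ.inf' univ_nonempty fun a => (s a).cum (k a) := by
  have h := MeasureTheory.measure_biUnion_finset (μ := MeasureTheory.volume)
    (s := Fintype.piFinset (rankBox k)) (f := rowSet s)
    (fun τ _ τ' _ hne => rowSet_disjoint s hne)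
    (fun τ _ => by rw [rowSet_eq_Ico]; exact measurableSet_Ico)
  rw [biUnion_rowSet, Real.volume_Ico, sub_zero, ENNReal.ofReal_coe_nnreal] at h
  simp only [volume_rowSet] at h
  rw [boxSum]
  exact_mod_cast h.symm

theorem antitoneSlices_worstCaseMult (s : A → DegreeSequence) :
    AntitoneSlices (worstCaseMult s) := by
  intro k a i hi
  set G : ℕ → ℝ≥0 := fun j => boxSum (worstCaseMult s) (rankBox (Function.update k a j)) with hG
  have hstep : ∀ j, G (j + 1) =
      G j + boxSum (worstCaseMult s) (Function.update (rankBox k) a {j + 1}) := by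
    intro j
    simp only [hG, ← update_rankBox]
    rw [boxSum_update, sum_Icc_succ_top (Nat.le_add_left 1 j), ← boxSum_update]
  have hGle : ∀ j, G j ≤ (s a).cum j := by
    intro j
    simp only [hG, boxSum_worstCaseMult]
    exact (inf'_le _ (mem_univ a)).trans (by simp)
  -- the other columns bound `G j` from below by `G (i + 1)`
  have hleG : ∀ j, min ((s a).cum j) (G (i + 1)) ≤ G j := by
    intro j
    simp only [hG, boxSum_worstCaseMult]
    rw [le_inf'_iff]
    intro b _
    by_cases hb : b = a
    · subst hb; simp
    · exact (min_le_right _ _).trans ((inf'_le _ (mem_univ b)).trans (by simp [hb]))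
  obtain ⟨i, rfl⟩ : ∃ n, i = n + 1 := ⟨i - 1, by omega⟩
  have h1 := hstep i
  have h2 := hstep (i + 1)
  have hf := (s a).nonincreasing (i + 1) hi
  have c1 := (s a).cum_succ i
  have c2 := (s a).cum_succ (i + 1)
  have g0 := hleG (i + 1)
  have l0 := hGle i
  have l2 := hGle (i + 1 + 1)
  set x := boxSum (worstCaseMult s) (Function.update (rankBox k) a {i + 1})
  set y := boxSum (worstCaseMult s) (Function.update (rankBox k) a {i + 1 + 1})
  rcases le_total ((s a).cum (i + 1)) (G (i + 1 + 1)) with h | h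
  · rw [min_eq_left h] at g0
    rw [← NNReal.coe_le_coe] at *
    rw [← NNReal.coe_inj] at *
    push_cast at *
    linarith
  · rw [min_eq_right h, h2] at g0
    exact (le_of_add_le_add_left (g0.trans (add_zero _).ge)).trans zero_le

end WorstCase

/-! ### Degree sequences of a relation -/

theorem sum_le_sum_take_of_sublist {l' l : List ℕ} (h : l'.Sublist l) (hl : l.Pairwise (· ≥ ·)) :
    l'.sum ≤ (l.take l'.length).sum := by
  induction l generalizing l' with
  | nil => simp [List.sublist_nil.1 h]
  | cons a l ih =>
    rw [List.pairwise_cons] at hl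
    cases l' with
    | nil => simp
    | cons b l' =>
      simp only [List.sum_cons, List.length_cons, List.take_succ_cons]
      have hb : b ≤ a := by
        rcases List.mem_cons.1 (h.subset List.mem_cons_self) with rfl | hb
        · exact le_rfl
        · exact hl.1 b hb
      have hsub : l'.Sublist l := by
        cases h with
        | cons _ h => exact (List.sublist_cons_self b l').trans h
        | cons_cons _ h => exact h
      exact add_le_add hb (ih hsub hl.2)

theorem sum_Icc_getD (l : List ℕ) (k : ℕ) :
    ∑ j ∈ Icc 1 k, l.getD (j - 1) 0 = (l.take k).sum := by
  induction k with
  | zero => simp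
  | succ k ih =>
    rw [sum_Icc_succ_top (Nat.le_add_left 1 k), ih, Nat.add_sub_cancel]
    rcases lt_or_ge k l.length with h | h
    · rw [List.sum_take_succ l k h, List.getD_eq_getElem l 0 h]
    · rw [List.getD_eq_default l 0 h, List.take_of_length_le h, List.take_of_length_le (by omega),
        add_zero]

section Freq

variable {A Dom : Type*}

/-- Any `k` frequencies of a column sum to at most the `k` largest ones. -/
theorem sum_freq_le_cumDegSeq (R : Bag ℕ (A → Dom)) (a : A) (T : Finset Dom) :
    ∑ x ∈ T, freq R a x ≤ cumDegSeq R a #T := by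
  classical
  -- values outside the column have frequency zero and do not appear in `sortedFreqs`
  set C := R.support.image fun τ => τ a with hC
  have hzero : ∀ x ∈ T, x ∉ T ∩ C → freq R a x = 0 := by
    intro x hxT hx
    have hxC : x ∉ C := fun h => hx (mem_inter.2 ⟨hxT, h⟩)
    refine sum_eq_zero fun τ hτ => if_neg ?_
    rintro rfl
    exact hxC (mem_image_of_mem (fun τ : A → Dom => τ a) hτ)
  rw [← sum_subset inter_subset_left hzero]
  have hle : ((T ∩ C).val.map (freq R a)) ≤ (sortedFreqs R a : Multiset ℕ) := by
    rw [sortedFreqs, Multiset.sort_eq]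
    convert Multiset.map_le_map (f := freq R a) (val_le_iff.2 (inter_subset_right : T ∩ C ⊆ C))
  obtain ⟨l, hperm, hsub⟩ : ∃ l : List ℕ, (l : Multiset ℕ) = (T ∩ C).val.map (freq R a) ∧
      l.Sublist (sortedFreqs R a) := by
    induction h : (T ∩ C).val.map (freq R a) using Quotient.inductionOn with
    | _ m =>
      rw [h] at hle
      obtain ⟨l, hp, hs⟩ := Multiset.coe_le.1 hle
      exact ⟨l, Multiset.coe_eq_coe.2 hp, hs⟩
  have hsum : ∑ x ∈ T ∩ C, freq R a x = l.sum := by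
    rw [Finset.sum, ← hperm, Multiset.sum_coe]
  have hlen : l.length = #(T ∩ C) := by
    rw [← Multiset.coe_card, hperm, Multiset.card_map]; rfl
  have hsorted : (sortedFreqs R a).Pairwise (· ≥ ·) := Multiset.pairwise_sort _ _
  calc ∑ x ∈ T ∩ C, freq R a x = l.sum := hsum
    _ ≤ ((sortedFreqs R a).take l.length).sum := sum_le_sum_take_of_sublist hsub hsorted
    _ = cumDegSeq R a #(T ∩ C) := by rw [hlen, cumDegSeq, ← sum_Icc_getD]; rfl
    _ ≤ cumDegSeq R a #T :=
        sum_le_sum_of_subset (Icc_subset_Icc_right (card_le_card inter_subset_left))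

variable [Fintype A] [DecidableEq A]

theorem boxSum_le_cumDegSeq (R : Bag ℕ (A → Dom)) (S : A → Finset Dom) (a : A) :
    boxSum (fun τ => (R τ : ℝ≥0)) S ≤ cumDegSeq R a #(S a) := by
  classical
  rw [boxSum, ← Nat.cast_sum, Nat.cast_le]
  refine le_trans ?_ (sum_freq_le_cumDegSeq R a (S a))
  simp only [freq, Finsupp.sum]
  rw [sum_comm]
  calc ∑ τ ∈ Fintype.piFinset S, R τ
      = ∑ τ ∈ Fintype.piFinset S with τ ∈ R.support, R τ := by
        rw [sum_filter]
        exact sum_congr rfl fun τ _ => by split_ifs with h <;> simp_all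
    _ ≤ ∑ τ ∈ R.support with τ a ∈ S a, R τ := by
        refine sum_le_sum_of_subset fun τ hτ => ?_
        rw [mem_filter] at hτ ⊢
        exact ⟨hτ.2, Fintype.mem_piFinset.1 hτ.1 a⟩
    _ = _ := by
        rw [sum_filter]
        exact sum_congr rfl fun τ _ => by simp

variable [Nonempty A]

theorem majorizedBy_worstCaseMult (R : Bag ℕ (A → Dom)) (S : A → CumulativeDegreeSequence)
    (h : ∀ a i, (cumDegSeq R a i : ℝ≥0) ≤ (S a).F i) :
    MajorizedBy (fun τ => (R τ : ℝ≥0)) (worstCaseMult fun a => (S a).delta) := by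
  intro T
  rw [boxSum_worstCaseMult, le_inf'_iff]
  intro a _
  rw [CumulativeDegreeSequence.cum_delta]
  exact (boxSum_le_cumDegSeq R T a).trans (h a _)

end Freq

/-! ### Tensors of a single atom -/

section Comp

variable {A V X : Type*} [Fintype A] [DecidableEq A] [Fintype V] [DecidableEq V]

/-- A tensor that reads only the variables in the range of `e` is constant in the others, so each
of these contributes the side length of the box. -/
theorem boxSum_comp (f : (A → X) → ℝ≥0) {e : A → V} (he : Function.Injective e)
    (S : V → Finset X) :
    boxSum (fun θ => f fun a => θ (e a)) S =
      boxSum f (fun a => S (e a)) * ∏ v with v ∉ Set.range e, (#(S v) : ℝ≥0) := by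
  classical
  unfold boxSum
  rw [← sum_fiberwise_of_maps_to (t := Fintype.piFinset fun a => S (e a))
    (g := fun (θ : V → X) a => θ (e a)), sum_mul]
  · refine sum_congr rfl fun τ hτ => ?_
    rw [sum_congr rfl (g := fun _ => f τ), sum_const, nsmul_eq_mul, mul_comm]
    · congr 1
      have hfib : {θ ∈ Fintype.piFinset S | (fun a => θ (e a)) = τ} =
          Fintype.piFinset fun v => {x ∈ S v | ∀ a, e a = v → x = τ a} := by
        ext θ
        simp only [mem_filter, Fintype.mem_piFinset, funext_iff]
        constructor
        · rintro ⟨h1, h2⟩ v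
          exact ⟨h1 v, by rintro a rfl; exact h2 a⟩
        · intro h
          exact ⟨fun v => (h v).1, fun a => (h (e a)).2 a rfl⟩
      rw [hfib, Fintype.card_piFinset, Nat.cast_prod, prod_filter]
      refine prod_congr rfl fun v _ => ?_
      split_ifs with hv
      · obtain ⟨a, rfl⟩ := hv
        rw [Nat.cast_eq_one, card_eq_one]
        refine ⟨τ a, ?_⟩
        ext x
        simp only [mem_filter, mem_singleton]
        constructor
        · rintro ⟨-, h⟩
          exact h a rfl
        · rintro rfl
          exact ⟨Fintype.mem_piFinset.1 hτ a, fun b hb => by rw [he hb]⟩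
      · congr 2
        exact filter_true_of_mem fun x _ a ha => absurd ⟨a, ha⟩ hv
    · intro θ hθ
      rw [(mem_filter.1 hθ).2]
  · intro θ hθ
    rw [Fintype.mem_piFinset] at hθ ⊢
    exact fun a => hθ (e a)

theorem MajorizedBy.comp {f : (A → X) → ℝ≥0} {g : (A → ℕ) → ℝ≥0} (h : MajorizedBy f g)
    {e : A → V} (he : Function.Injective e) :
    MajorizedBy (fun θ => f fun a => θ (e a)) (fun θ => g fun a => θ (e a)) := by
  intro S
  rw [boxSum_comp f he, boxSum_comp g he]
  refine mul_le_mul' (h _) (le_of_eq ?_)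
  simp [rankBox]

theorem AntitoneSlices.comp {g : (A → ℕ) → ℝ≥0} (h : AntitoneSlices g)
    {e : A → V} (he : Function.Injective e) : AntitoneSlices fun θ => g fun a => θ (e a) := by
  classical
  intro k v i hi
  rw [boxSum_comp g he, boxSum_comp g he]
  refine mul_le_mul' ?_ (le_of_eq ?_)
  · by_cases hv : v ∈ Set.range e
    · obtain ⟨a, rfl⟩ := hv
      have hcomp : ∀ T : Finset ℕ, (fun b => Function.update (rankBox k) (e a) T (e b)) =
          Function.update (rankBox fun b => k (e b)) a T := by
        intro T
        exact Function.update_comp_eq_of_injective _ he a T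
      rw [hcomp, hcomp]
      exact h _ a i hi
    · have hcomp : ∀ T : Finset ℕ, (fun b => Function.update (rankBox k) v T (e b)) =
          fun b => rankBox k (e b) := fun T =>
        funext fun b => Function.update_of_ne (fun hb => hv ⟨b, hb⟩) _ _
      rw [hcomp, hcomp]
  · refine prod_congr rfl fun u _ => ?_
    by_cases hu : u = v
    · subst hu; simp
    · simp [hu]

end Comp

/-! ### Leaves of Berge-acyclic queries -/

/-- A finite acyclic graph has a vertex with at most one neighbour: otherwise every path could be
prolonged. -/
theorem exists_subsingleton_neighborSet {V : Type*} [Finite V] [Nonempty V] {G : SimpleGraph V}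
    (hG : G.IsAcyclic) : ∃ v, (G.neighborSet v).Subsingleton := by
  classical
  have := Fintype.ofFinite V
  by_contra! hne
  have hpath : ∀ n, ∃ (u w : V) (p : G.Walk u w), p.IsPath ∧ p.length = n := by
    intro n
    induction n with
    | zero => exact ⟨Classical.arbitrary V, _, .nil, .nil, rfl⟩
    | succ n ih =>
      obtain ⟨u, w, p, hp, hlen⟩ := ih
      obtain ⟨x, hx, hxne⟩ : ∃ x, G.Adj w x ∧ x ≠ p.penultimate := by
        obtain ⟨x, hx, y, hy, hxy⟩ := hne w
        by_cases h : x = p.penultimate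
        · exact ⟨y, hy, fun hy' => hxy (h.trans hy'.symm)⟩
        · exact ⟨x, hx, h⟩
      have hmem : x ∉ p.support := fun hs => hxne (hG.eq_penultimate_of_adj_end hp hx hs)
      exact ⟨u, x, p.concat hx, hp.concat hmem hx, by simp [hlen]⟩
  obtain ⟨u, w, p, hp, hlen⟩ := hpath (Fintype.card V)
  exact absurd hp.length_lt (by omega)

section Query

variable {Rel : Type*} {Attr : Rel → Type*} {Atom Var : Type*}

theorem CQ.adj_incidenceGraph (Q : CQ Attr Atom Var) (i : Atom) (a : Attr (Q.rel i)) :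
    Q.incidenceGraph.Adj (Sum.inl i) (Sum.inr (Q.var i a)) := by
  rw [CQ.incidenceGraph, SimpleGraph.fromRel_adj]
  exact ⟨Sum.inl_ne_inr, Or.inl ⟨i, a, rfl, rfl⟩⟩

/-- In a Berge-acyclic query every non-empty set of atoms contains a leaf: an atom that shares at
most one variable with the other atoms of the set. -/
theorem CQ.BergeAcyclic.exists_leaf [∀ r, Nonempty (Attr r)] [Finite Atom] [Finite Var]
    {Q : CQ Attr Atom Var} (hQ : Q.BergeAcyclic) {s : Finset Atom} (hs : s.Nonempty) :
    ∃ i ∈ s, ∃ v, ∀ a, ∀ j ∈ s, j ≠ i → ∀ b, Q.var j b = Q.var i a → Q.var i a = v := by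
  -- the incidence graph, restricted to the atoms of `s` and the variables that they share
  let U : Set (Atom ⊕ Var) := {x | (∃ i ∈ s, x = Sum.inl i) ∨
    ∃ i ∈ s, ∃ j ∈ s, i ≠ j ∧ ∃ a b, x = Sum.inr (Q.var i a) ∧ x = Sum.inr (Q.var j b)}
  obtain ⟨i₀, hi₀⟩ := hs
  have : Nonempty U := ⟨⟨Sum.inl i₀, Or.inl ⟨i₀, hi₀, rfl⟩⟩⟩
  obtain ⟨⟨x, hx⟩, hsub⟩ := exists_subsingleton_neighborSet (hQ.induce U)
  have hx' := hx
  rcases hx' with ⟨i, hi, rfl⟩ | ⟨i, hi, j, hj, hij, a, b, rfl, hb⟩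
  · have hshared : ∀ a, ∀ j ∈ s, j ≠ i → ∀ b, Q.var j b = Q.var i a →
        ∃ h : Sum.inr (Q.var i a) ∈ U,
          (⟨_, h⟩ : U) ∈ (Q.incidenceGraph.induce U).neighborSet ⟨Sum.inl i, hx⟩ :=
      fun a j hj hji b hb =>
        ⟨Or.inr ⟨i, hi, j, hj, hji.symm, a, b, rfl, by rw [hb]⟩, Q.adj_incidenceGraph i a⟩
    refine ⟨i, hi, ?_⟩
    by_cases hex : ∃ a, ∃ j ∈ s, j ≠ i ∧ ∃ b, Q.var j b = Q.var i a
    · obtain ⟨a₀, j₀, hj₀, hne₀, b₀, hb₀⟩ := hex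
      refine ⟨Q.var i a₀, fun a j hj hji b hb => ?_⟩
      obtain ⟨h1, h1'⟩ := hshared a₀ j₀ hj₀ hne₀ b₀ hb₀
      obtain ⟨h2, h2'⟩ := hshared a j hj hji b hb
      exact Sum.inr_injective (congrArg Subtype.val (hsub h2' h1'))
    · refine ⟨Q.var i (Classical.arbitrary _), fun a j hj hji b hb => ?_⟩
      exact absurd ⟨a, j, hj, hji, b, hb⟩ hex
  · -- a shared variable has two neighbours
    have hi' : Sum.inl i ∈ U := Or.inl ⟨i, hi, rfl⟩
    have hj' : Sum.inl j ∈ U := Or.inl ⟨j, hj, rfl⟩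
    have h1 : (⟨_, hi'⟩ : U) ∈
        (Q.incidenceGraph.induce U).neighborSet ⟨Sum.inr (Q.var i a), hx⟩ :=
      (Q.adj_incidenceGraph i a).symm
    have h2 : (⟨_, hj'⟩ : U) ∈
        (Q.incidenceGraph.induce U).neighborSet ⟨Sum.inr (Q.var i a), hx⟩ := by
      have := (Q.adj_incidenceGraph j b).symm
      rwa [← hb] at this
    exact absurd (Sum.inl_injective (congrArg Subtype.val (hsub h1 h2))) hij

theorem CQ.dependsOn_atom [∀ r, Fintype (Attr r)] [DecidableEq Var] {X : Type*}
    (Q : CQ Attr Atom Var) (i : Atom) (v : Var) (w : (Attr (Q.rel i) → X) → ℝ≥0) :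
    DependsOn (fun θ : Var → X => w fun a => θ (Q.var i a))
      (insert v ((univ.image (Q.var i) : Finset Var) : Set Var)) := by
  intro θ θ' h
  exact congrArg w (funext fun a => h _ (Or.inr (by simp)))

theorem CQ.dependsOn_prod_erase [∀ r, Fintype (Attr r)] [DecidableEq Var] [DecidableEq Atom]
    {X : Type*} (Q : CQ Attr Atom Var) {s : Finset Atom} {i : Atom} {v : Var}
    (hv : ∀ a, ∀ j ∈ s, j ≠ i → ∀ b, Q.var j b = Q.var i a → Q.var i a = v)
    (w : (j : Atom) → (Attr (Q.rel j) → X) → ℝ≥0) :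
    DependsOn (fun θ : Var → X => ∏ j ∈ s.erase i, w j fun a => θ (Q.var j a))
      (insert v ((univ.image (Q.var i) : Finset Var) : Set Var)ᶜ) := by
  intro θ θ' h
  refine prod_congr rfl fun j hj => congrArg (w j) (funext fun b => h _ ?_)
  by_cases hmem : Q.var j b ∈ univ.image (Q.var i)
  · obtain ⟨a, -, ha⟩ := mem_image.1 hmem
    left
    rw [← ha]
    exact hv a j (mem_of_mem_erase hj) (ne_of_mem_erase hj) b ha.symm
  · exact Or.inr hmem

variable [∀ r, Fintype (Attr r)] [∀ r, Nonempty (Attr r)] [Finite Atom] [Fintype Var]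
  [DecidableEq Var] {Dom : Type*}

/-- For every set of atoms of a Berge-acyclic query, the tensor of the multiplicities in `D` is
submajorized by the one in the worst-case instance, whose slice sums are non-increasing. -/
theorem CQ.BergeAcyclic.majorizedBy_prod {Q : CQ Attr Atom Var} (hQ : Q.BergeAcyclic)
    {S : (r : Rel) → Attr r → CumulativeDegreeSequence} {D : Database ℕ Attr Dom}
    (hD : Satisfies D S) (s : Finset Atom) :
    MajorizedBy (fun θ : Var → Dom => ∏ i ∈ s, (D (Q.rel i) fun a => θ (Q.var i a) : ℝ≥0))
        (fun θ => ∏ i ∈ s, worstCaseMult (fun a => (S (Q.rel i) a).delta)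
          fun a => θ (Q.var i a)) ∧
      AntitoneSlices fun θ : Var → ℕ => ∏ i ∈ s,
        worstCaseMult (fun a => (S (Q.rel i) a).delta) fun a => θ (Q.var i a) := by
  classical
  induction s using Finset.strongInduction with
  | _ s ih =>
  rcases s.eq_empty_or_nonempty with rfl | hs
  · constructor
    · intro T
      simp [boxSum, rankBox]
    · intro k v i _
      simp only [boxSum, prod_empty, sum_const, Fintype.card_piFinset]
      refine le_of_eq ?_
      congr 1
      refine prod_congr rfl fun u _ => ?_
      by_cases hu : u = v
      · subst hu; simp
      · simp [hu]
  obtain ⟨i, hi, v, hv⟩ := hQ.exists_leaf hs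
  obtain ⟨ih1, ih2⟩ := ih (s.erase i) (erase_ssubset hi)
  have h1 := (majorizedBy_worstCaseMult (D (Q.rel i)) (S (Q.rel i)) (hD _)).comp
    (Q.var_injective i)
  have h2 := (antitoneSlices_worstCaseMult fun a => (S (Q.rel i) a).delta).comp
    (Q.var_injective i)
  simp only [← mul_prod_erase s _ hi]
  exact ⟨h1.mul (Q.dependsOn_atom i v fun τ => (D (Q.rel i) τ : ℝ≥0))
      (Q.dependsOn_prod_erase hv fun j τ => (D (Q.rel j) τ : ℝ≥0)) (Q.dependsOn_atom i v _)
      (Q.dependsOn_prod_erase hv fun j => worstCaseMult fun a => (S (Q.rel j) a).delta) ih1 h2,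
    h2.mul (Q.dependsOn_atom i v _)
      (Q.dependsOn_prod_erase hv fun j => worstCaseMult fun a => (S (Q.rel j) a).delta) ih2⟩

end Query

/-! ### Cardinalities -/

theorem Bag.exists_box {K V X : Type*} [Zero K] (b : Bag K (V → X)) :
    ∃ S : V → Finset X, ∀ θ, b θ ≠ 0 → ∀ v, θ v ∈ S v := by
  classical
  exact ⟨fun v => b.support.image fun θ => θ v, fun θ hθ v =>
    mem_image_of_mem (fun θ : V → X => θ v) (Finsupp.mem_support_iff.2 hθ)⟩

section Size

variable {V X : Type*} [Fintype V] [DecidableEq V]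

theorem Bag.boxSum_le_size (b : Bag ℝ≥0 (V → X)) (S : V → Finset X) : boxSum b S ≤ b.size := by
  classical
  rw [boxSum, Bag.size, Finsupp.sum, ← sum_filter_ne_zero]
  exact sum_le_sum_of_subset fun θ hθ => Finsupp.mem_support_iff.2 (mem_filter.1 hθ).2

theorem Bag.size_eq_boxSum {K : Type*} [AddCommMonoid K] (b : Bag K (V → X)) {S : V → Finset X}
    (h : ∀ θ, b θ ≠ 0 → ∀ v, θ v ∈ S v) : b.size = ∑ θ ∈ Fintype.piFinset S, b θ :=
  Finsupp.sum_of_support_subset b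
    (fun θ hθ => Fintype.mem_piFinset.2 (h θ (Finsupp.mem_support_iff.1 hθ))) _ fun _ _ => rfl

end Size

section WorstCaseSize

variable {A : Type*} [Fintype A] [Nonempty A]

theorem inf'_cum_le_size_worstCaseRelation (s : A → DegreeSequence) (k : A → ℕ) :
    (univ.inf' univ_nonempty fun a => (s a).cum (k a)) ≤ (worstCaseRelation s).size := by
  classical
  rw [← boxSum_worstCaseMult]
  exact Bag.boxSum_le_size (worstCaseRelation s) (rankBox k)

/-- The worst-case relation is contained in a box of first ranks, so its cardinality is a box
sum. -/
theorem exists_size_worstCaseRelation_eq (s : A → DegreeSequence) :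
    ∃ k : A → ℕ, (worstCaseRelation s).size =
      univ.inf' univ_nonempty fun a => (s a).cum (k a) := by
  classical
  obtain ⟨T, hT⟩ := (worstCaseRelation s).exists_box
  refine ⟨fun a => (T a).sup id, le_antisymm ?_ (inf'_cum_le_size_worstCaseRelation s _)⟩
  rw [← boxSum_worstCaseMult, Bag.size_eq_boxSum _ (S := rankBox fun a => (T a).sup id)]
  · exact le_rfl
  · intro τ hτ a
    refine mem_Icc.2 ⟨Nat.one_le_iff_ne_zero.2 fun h0 => hτ ?_,
      le_sup (f := id) (hT τ hτ a)⟩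
    -- the rank `0` does not occur
    change worstCaseMult s τ = 0
    refine tsub_eq_zero_of_le (((inf'_le _ (mem_univ a)).trans ?_).trans zero_le)
    rw [h0, DegreeSequence.cum_zero]

theorem size_worstCaseRelation_eq {Dom : Type*} (R : Bag ℕ (A → Dom))
    (S : A → CumulativeDegreeSequence) (h : ∀ a i, (cumDegSeq R a i : ℝ≥0) ≤ (S a).F i) {a : A}
    (ha : ∀ᶠ i in Filter.atTop, (S a).F i = (R.size : ℝ≥0)) :
    (worstCaseRelation fun a => (S a).delta).size = (R.size : ℝ≥0) := by
  classical
  obtain ⟨n, hn⟩ := Filter.eventually_atTop.1 ha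
  apply le_antisymm
  · obtain ⟨k, hk⟩ := exists_size_worstCaseRelation_eq fun a => (S a).delta
    rw [hk]
    calc _ ≤ (S a).delta.cum (k a) := inf'_le _ (mem_univ a)
      _ = (S a).F (k a) := (S a).cum_delta _
      _ ≤ (S a).F (max n (k a)) := (S a).mono (le_max_right _ _)
      _ = _ := hn _ (le_max_left _ _)
  · obtain ⟨T, hT⟩ := R.exists_box
    rw [R.size_eq_boxSum hT, Nat.cast_sum]
    refine (majorizedBy_worstCaseMult R S h T).trans ?_
    rw [boxSum_worstCaseMult]
    exact inf'_cum_le_size_worstCaseRelation _ _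

end WorstCaseSize

end SafeBound

theorem theorem3p2 {Rel : Type*} {Attr : Rel → Type*} [∀ r, Fintype (Attr r)]
    [∀ r, Nonempty (Attr r)] {Atom Var Dom : Type*} [Fintype Atom]
    (Q : SafeBound.CQ Attr Atom Var) (hQ : Q.BergeAcyclic)
    (S : (r : Rel) → Attr r → SafeBound.CumulativeDegreeSequence)
    (D : SafeBound.Database ℕ Attr Dom) (hD : SafeBound.Satisfies D S) :
    ((Q.eval D).size : ℝ≥0) ≤
        (Q.eval (SafeBound.worstCase fun r a => (S r a).delta)).size ∧
      ∀ r a, (∀ᶠ i in Filter.atTop, (S r a).F i = ((D r).size : ℝ≥0)) →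
        (SafeBound.worstCase (fun r a => (S r a).delta) r).size = ((D r).size : ℝ≥0) := by
  classical
  refine ⟨?_, fun r a ha => SafeBound.size_worstCaseRelation_eq (D r) (S r) (hD r) ha⟩
  have hfin : Finite Var := Finite.of_surjective
    (fun p : (i : Atom) × Attr (Q.rel i) => Q.var p.1 p.2) fun v => by
      obtain ⟨i, a, h⟩ := Q.var_occurs v
      exact ⟨⟨i, a⟩, h⟩
  have := Fintype.ofFinite Var
  obtain ⟨T, hT⟩ := (Q.eval D).exists_box
  rw [SafeBound.Bag.size_eq_boxSum _ hT, Nat.cast_sum]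
  refine le_trans (le_of_eq ?_) (((hQ.majorizedBy_prod hD Finset.univ).1 T).trans
    (SafeBound.Bag.boxSum_le_size (Q.eval (SafeBound.worstCase fun r a => (S r a).delta)) _))
  exact Finset.sum_congr rfl fun θ _ => Nat.cast_prod _ _
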